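/- Let $k \ge 3$ be an integer and let $H$ be a finite $k$-uniform hypergraph without multiple edges (its edges form a set of $k$-element subsets of the finite vertex set $V(H)$), with no isolated vertices (every vertex lies in some edge) and no isolated edges (every edge intersects some other edge). Let $n_H = |V(H)|$ and $m_H = |E(H)|$. A total transversal of $H$ is a set $T \subseteq V(H)$ that intersects every edge of $H$ and in which every vertex $v \in T$ has a neighbor in $T$, that is, there is a vertex $u \in T$ with $u \ne v$ such that some edge of $H$ contains both $u$ and $v$. Then $H$ has a total transversal, and the minimum size $\tau_t(H)$ of a total transversal of $H$ satisfies \[ \tau_t(H) \le \frac{n_H + m_H}{3}. \] -/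

import Mathlib

namespace Hypergraph

variable {α : Type*}

/-- The order of a hypergraph: its number of vertices. -/
noncomputable def order (H : Hypergraph α) : ℕ := H.vertexSet.ncard

/-- The size of a hypergraph: its number of edges. -/
noncomputable def size (H : Hypergraph α) : ℕ := H.edgeSet.ncard

/-- Every edge consists of exactly `k` vertices. -/
def IsUniform (H : Hypergraph α) (k : ℕ) : Prop :=
  ∀ e ∈ H.edgeSet, e.Finite ∧ e.ncard = k

/-- An isolated edge is an edge that does not intersect any other edge. -/
def IsIsolatedEdge (H : Hypergraph α) (e : Set α) : Prop :=
  e ∈ H.edgeSet ∧ ∀ f ∈ H.edgeSet, f ≠ e → Disjoint e f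

/-- `u` is a neighbor of `v`: the two vertices are different and lie in a common edge. -/
def IsNeighbor (H : Hypergraph α) (u v : α) : Prop := u ≠ v ∧ H.Adj u v

/-- A transversal is a set of vertices that meets every edge. -/
def IsTransversal (H : Hypergraph α) (T : Set α) : Prop :=
  T ⊆ H.vertexSet ∧ ∀ e ∈ H.edgeSet, (T ∩ e).Nonempty

/-- A total transversal is a transversal each of whose vertices has a neighbor in it. -/
def IsTotalTransversal (H : Hypergraph α) (T : Set α) : Prop :=
  H.IsTransversal T ∧ ∀ v ∈ T, ∃ u ∈ T, H.IsNeighbor u v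

/-- The total transversal number: the minimum size of a total transversal. -/
noncomputable def totalTransversalNumber (H : Hypergraph α) : ℕ :=
  sInf {t : ℕ | ∃ T : Set α, H.IsTotalTransversal T ∧ T.ncard = t}

/-- The class of finite `k`-uniform hypergraphs with no isolated vertices and no isolated edges.
Multiple edges are excluded because the edges of a `Hypergraph` form a set. -/
structure MemClass (k : ℕ) (H : Hypergraph α) : Prop where
  finite : H.vertexSet.Finite
  uniform : H.IsUniform k
  no_isolated_vertex : ∀ v ∈ H.vertexSet, ¬ H.IsIsolated v
  no_isolated_edge : ∀ e : Set α, ¬ H.IsIsolatedEdge e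

end Hypergraph

namespace Hypergraph.Family

open Finset

variable {α : Type*}

/-- `e` meets no other member of `F`. -/
def Isolated (F : Finset (Finset α)) (e : Finset α) : Prop :=
  e ∈ F ∧ ∀ f ∈ F, ∀ v ∈ e, v ∈ f → f = e

/-- `C` contains every member of `F` that meets a member of `C`. -/
def IsClosedIn (F C : Finset (Finset α)) : Prop :=
  ∀ e ∈ C, ∀ f ∈ F, ∀ v ∈ e, v ∈ f → f ∈ C

/-- Every nonempty union of components of `F` has a vertex of degree one. -/
def HasPendants (F : Finset (Finset α)) : Prop :=
  ∀ C ⊆ F, C.Nonempty → IsClosedIn F C → ∃ e ∈ C, ∃ v ∈ e, ∀ f ∈ F, v ∈ f → f = e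

/-- Every vertex lies in at most two members of `F`. -/
def DegreeLeTwo (F : Finset (Finset α)) : Prop :=
  ∀ v, ∀ e ∈ F, ∀ f ∈ F, ∀ g ∈ F, v ∈ e → v ∈ f → v ∈ g → e = f ∨ e = g ∨ f = g

/-- Two different members of `F` have at most one vertex in common. -/
def Linear (F : Finset (Finset α)) : Prop :=
  ∀ e ∈ F, ∀ f ∈ F, e ≠ f → ∀ u ∈ e, u ∈ f → ∀ v ∈ e, v ∈ f → u = v

lemma DegreeLeTwo.mono {F F' : Finset (Finset α)} (h : DegreeLeTwo F) (hF : F' ⊆ F) :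
    DegreeLeTwo F' :=
  fun v e he f hf g hg => h v e (hF he) f (hF hf) g (hF hg)

lemma Linear.mono {F F' : Finset (Finset α)} (h : Linear F) (hF : F' ⊆ F) : Linear F' :=
  fun e he f hf => h e (hF he) f (hF hf)

/-- A subfamily inherits pendant vertices if its closed subfamilies that are closed in the whole
family have them. -/
lemma DegreeLeTwo.hasPendants {F F' : Finset (Finset α)} (h2 : DegreeLeTwo F) (hF : F' ⊆ F)
    (h : ∀ C ⊆ F', C.Nonempty → IsClosedIn F C → ∃ e ∈ C, ∃ v ∈ e, ∀ f ∈ F, v ∈ f → f = e) :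
    HasPendants F' := by
  intro C hC hne hcl
  by_cases hcF : IsClosedIn F C
  · obtain ⟨e, he, v, hv, hvf⟩ := h C hC hne hcF
    exact ⟨e, he, v, hv, fun f hf => hvf f (hF hf)⟩
  · unfold IsClosedIn at hcF
    push Not at hcF
    obtain ⟨e, he, f, hf, v, hve, hvf, hfC⟩ := hcF
    have hfF' : f ∉ F' := fun hf' => hfC (hcl e he f hf' v hve hvf)
    refine ⟨e, he, v, hve, fun g hg hvg => ?_⟩
    rcases h2 v e (hF (hC he)) f hf g (hF hg) hve hvf hvg with rfl | rfl | rfl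
    · exact absurd he hfC
    · rfl
    · exact absurd hg hfF'

lemma HasPendants.mono {F F' : Finset (Finset α)} (h : HasPendants F) (h2 : DegreeLeTwo F)
    (hF : F' ⊆ F) : HasPendants F' :=
  h2.hasPendants hF fun C hC => h C (hC.trans hF)

lemma card_lt_of_subset_of_notMem {F F' : Finset (Finset α)} {e : Finset α} (hF : F' ⊆ F)
    (he : e ∈ F) (he' : e ∉ F') : F'.card < F.card :=
  card_lt_card ⟨hF, fun h => he' (h he)⟩

lemma exists_mem_ne_of_three_le_card {e : Finset α} (he : 3 ≤ e.card) (x : α) :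
    ∃ y ∈ e, x ≠ y := by
  obtain ⟨y, hy, hne⟩ := exists_mem_ne (by omega : 1 < e.card) x
  exact ⟨y, hy, hne.symm⟩

variable [DecidableEq α]

/-- The number of vertices plus the number of edges of a finite family of edges. -/
def weight (F : Finset (Finset α)) : ℕ := (F.biUnion id).card + F.card

/-- For any prescribed representatives `c` of the isolated edges, there is a transversal with at
most `t` elements in which every vertex without a neighbor is a prescribed representative. -/
def Coverable (F : Finset (Finset α)) (t : ℕ) : Prop :=
  ∀ c : Finset α → α, (∀ e ∈ F, c e ∈ e) → ∃ T : Finset α, T.card ≤ t ∧ T ⊆ F.biUnion id ∧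
    (∀ e ∈ F, ∃ v ∈ T, v ∈ e) ∧
    ∀ v ∈ T, (∃ u ∈ T, u ≠ v ∧ ∃ e ∈ F, u ∈ e ∧ v ∈ e) ∨ ∃ e, Isolated F e ∧ v = c e

/-- The members of `F` that contain neither `x` nor `y`. -/
def avoiding (F : Finset (Finset α)) (x y : α) : Finset (Finset α) :=
  F.filter fun e => x ∉ e ∧ y ∉ e

lemma mem_avoiding {F : Finset (Finset α)} {x y : α} {e : Finset α} :
    e ∈ avoiding F x y ↔ e ∈ F ∧ x ∉ e ∧ y ∉ e := by
  simp [avoiding]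

lemma avoiding_subset (F : Finset (Finset α)) (x y : α) : avoiding F x y ⊆ F :=
  filter_subset _ _

lemma mem_biUnion_id {F : Finset (Finset α)} {v : α} : v ∈ F.biUnion id ↔ ∃ e ∈ F, v ∈ e := by
  simp

lemma coverable_empty : Coverable (∅ : Finset (Finset α)) 0 :=
  fun _ _ => ⟨∅, by simp⟩

lemma coverable_singleton (e : Finset α) : Coverable {e} 1 := by
  intro c hc
  refine ⟨{c e}, by simp, ?_, ?_, ?_⟩
  · simpa using hc e (by simp)
  · simpa using hc e (by simp)
  · intro v hv
    exact Or.inr ⟨e, ⟨by simp, by simp⟩, by simpa using hv⟩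

lemma Coverable.union {C D : Finset (Finset α)} {a b : ℕ}
    (h : ∀ e ∈ C, ∀ f ∈ D, ∀ v ∈ e, v ∉ f) (hC : Coverable C a) (hD : Coverable D b) :
    Coverable (C ∪ D) (a + b) := by
  intro c hc
  obtain ⟨T, hT, hTs, hT1, hT2⟩ := hC c fun e he => hc e (mem_union_left _ he)
  obtain ⟨S, hS, hSs, hS1, hS2⟩ := hD c fun e he => hc e (mem_union_right _ he)
  refine ⟨T ∪ S, (card_union_le _ _).trans (by omega), ?_, ?_, ?_⟩
  · rw [union_biUnion]
    exact union_subset_union hTs hSs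
  · intro e he
    rcases mem_union.1 he with he | he
    · obtain ⟨v, hv, hve⟩ := hT1 e he
      exact ⟨v, mem_union_left _ hv, hve⟩
    · obtain ⟨v, hv, hve⟩ := hS1 e he
      exact ⟨v, mem_union_right _ hv, hve⟩
  · intro v hv
    rcases mem_union.1 hv with hv | hv
    · rcases hT2 v hv with ⟨u, hu, huv, e, he, h1⟩ | ⟨e, ⟨he, hi⟩, hve⟩
      · exact Or.inl ⟨u, mem_union_left _ hu, huv, e, mem_union_left _ he, h1⟩
      · refine Or.inr ⟨e, ⟨mem_union_left _ he, fun f hf w hw hwf => ?_⟩, hve⟩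
        rcases mem_union.1 hf with hf | hf
        · exact hi f hf w hw hwf
        · exact absurd hwf (h e he f hf w hw)
    · rcases hS2 v hv with ⟨u, hu, huv, e, he, h1⟩ | ⟨e, ⟨he, hi⟩, hve⟩
      · exact Or.inl ⟨u, mem_union_right _ hu, huv, e, mem_union_right _ he, h1⟩
      · refine Or.inr ⟨e, ⟨mem_union_right _ he, fun f hf w hw hwf => ?_⟩, hve⟩
        rcases mem_union.1 hf with hf | hf
        · exact absurd hw (h f hf e he w hwf)
        · exact hi f hf w hw hwf

lemma Coverable.add_pair {F : Finset (Finset α)} {x y : α} {t : ℕ} (hxy : x ≠ y)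
    {e₀ : Finset α} (he₀ : e₀ ∈ F) (hx : x ∈ e₀) (hy : y ∈ e₀)
    (h : Coverable (avoiding F x y) t) : Coverable F (t + 2) := by
  classical
  intro c hc
  let P : Finset α → α → Prop := fun e v => v ∈ e ∧ ∃ f ∈ F, (x ∈ f ∨ y ∈ f) ∧ v ∈ f
  let c' : Finset α → α := fun e => if h : ∃ v, P e v then h.choose else c e
  have hc'P : ∀ e, (∃ v, P e v) → P e (c' e) := by
    intro e he
    simp only [c', dif_pos he]
    exact he.choose_spec
  have hc'N : ∀ e, (¬ ∃ v, P e v) → c' e = c e := by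
    intro e he
    simp only [c', dif_neg he]
  obtain ⟨T, hT, hTs, hT1, hT2⟩ := h c' (by
    intro e he
    by_cases hp : ∃ v, P e v
    · exact (hc'P e hp).1
    · rw [hc'N e hp]
      exact hc e (avoiding_subset _ _ _ he))
  refine ⟨T ∪ {x, y}, ?_, ?_, ?_, ?_⟩
  · have := card_union_le T {x, y}
    have := card_le_two (a := x) (b := y)
    omega
  · refine union_subset (hTs.trans (biUnion_subset_biUnion_of_subset_left _
      (avoiding_subset _ _ _))) ?_
    intro v hv
    rw [mem_biUnion_id]
    simp only [mem_insert, mem_singleton] at hv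
    rcases hv with rfl | rfl
    exacts [⟨_, he₀, hx⟩, ⟨_, he₀, hy⟩]
  · intro e he
    by_cases h1 : x ∈ e
    · exact ⟨x, by simp, h1⟩
    by_cases h2 : y ∈ e
    · exact ⟨y, by simp, h2⟩
    obtain ⟨v, hv, hve⟩ := hT1 e (mem_avoiding.2 ⟨he, h1, h2⟩)
    exact ⟨v, mem_union_left _ hv, hve⟩
  · intro v hv
    rcases mem_union.1 hv with hv | hv
    · rcases hT2 v hv with ⟨u, hu, huv, e, he, h1⟩ | ⟨e, ⟨he, hi⟩, hve⟩
      · exact Or.inl ⟨u, mem_union_left _ hu, huv, e, avoiding_subset _ _ _ he, h1⟩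
      · obtain ⟨heF, hxe, hye⟩ := mem_avoiding.1 he
        by_cases hp : ∃ v, P e v
        · obtain ⟨hve', f, hf, hxf, hvf⟩ := hc'P e hp
          rw [← hve] at hve' hvf
          rcases hxf with hxf | hyf
          · exact Or.inl ⟨x, by simp, fun h => hxe (h ▸ hve'), f, hf, hxf, hvf⟩
          · exact Or.inl ⟨y, by simp, fun h => hye (h ▸ hve'), f, hf, hyf, hvf⟩
        · refine Or.inr ⟨e, ⟨heF, fun f hf w hw hwf => ?_⟩, hve.trans (hc'N e hp)⟩
          by_cases hxf : x ∈ f ∨ y ∈ f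
          · exact absurd ⟨w, hw, f, hf, hxf, hwf⟩ hp
          · push Not at hxf
            exact hi f (mem_avoiding.2 ⟨hf, hxf⟩) w hw hwf
    · simp only [mem_insert, mem_singleton] at hv
      rcases hv with rfl | rfl
      · exact Or.inl ⟨y, by simp, hxy.symm, e₀, he₀, hy, hx⟩
      · exact Or.inl ⟨x, by simp, hxy, e₀, he₀, hx, hy⟩

lemma weight_union {C D : Finset (Finset α)} (hne : ∀ e ∈ C, e.Nonempty)
    (h : ∀ e ∈ C, ∀ f ∈ D, ∀ v ∈ e, v ∉ f) : weight (C ∪ D) = weight C + weight D := by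
  have h1 : Disjoint C D := by
    rw [disjoint_left]
    intro e he hf
    obtain ⟨v, hv⟩ := hne e he
    exact h e he e hf v hv hv
  have h2 : Disjoint (C.biUnion id) (D.biUnion id) := by
    rw [disjoint_left]
    intro v hv hv'
    obtain ⟨e, he, hve⟩ := mem_biUnion_id.1 hv
    obtain ⟨f, hf, hvf⟩ := mem_biUnion_id.1 hv'
    exact h e he f hf v hve hvf
  rw [weight, weight, weight, union_biUnion, card_union_of_disjoint h1, card_union_of_disjoint h2]
  omega

lemma weight_add_le {F F' R : Finset (Finset α)} {U : Finset α} (hF : F' ⊆ F) (hR : R ⊆ F)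
    (hU : U ⊆ F.biUnion id) (hRF : ∀ e ∈ R, e ∉ F') (hUF : ∀ v ∈ U, ∀ e ∈ F', v ∉ e) :
    weight F' + R.card + U.card ≤ weight F := by
  have h1 : Disjoint F' R := disjoint_right.2 hRF
  have h2 : Disjoint (F'.biUnion id) U := by
    rw [disjoint_right]
    intro v hv hv'
    obtain ⟨e, he, hve⟩ := mem_biUnion_id.1 hv'
    exact hUF v hv e he hve
  have h3 := card_le_card (union_subset hF hR)
  have h4 := card_le_card (union_subset (biUnion_subset_biUnion_of_subset_left id hF) hU)
  rw [card_union_of_disjoint h1] at h3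
  rw [card_union_of_disjoint h2] at h4
  unfold weight
  omega

lemma four_le_card_union {e f : Finset α} (he : 3 ≤ e.card) (hf : 3 ≤ f.card) (h : e ≠ f) :
    4 ≤ (e ∪ f).card := by
  by_contra! hlt
  have h1 : e = e ∪ f := eq_of_subset_of_card_le subset_union_left (by omega)
  have h2 : f = e ∪ f := eq_of_subset_of_card_le subset_union_right (by omega)
  exact h (h1.trans h2.symm)

lemma Linear.five_le_card_union {F : Finset (Finset α)} (hF : Linear F) {e f : Finset α}
    (he : e ∈ F) (hf : f ∈ F) (hne : e ≠ f) (h3e : 3 ≤ e.card) (h3f : 3 ≤ f.card) :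
    5 ≤ (e ∪ f).card := by
  have h1 : (e ∩ f).card ≤ 1 := by
    rw [card_le_one]
    intro u hu v hv
    rw [mem_inter] at hu hv
    exact hF e he f hf hne u hu.1 hu.2 v hv.1 hv.2
  have := card_union_add_card_inter e f
  omega

lemma IsClosedIn.disjoint_sdiff {F C : Finset (Finset α)} (h : IsClosedIn F C) :
    ∀ e ∈ C, ∀ f ∈ F \ C, ∀ v ∈ e, v ∉ f := by
  intro e he f hf v hve hvf
  rw [mem_sdiff] at hf
  exact hf.2 (h e he f hf.1 v hve hvf)

/-- In a linear family of maximum degree two with a pendant vertex in every component, the bound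
holds with room to spare. -/
theorem HasPendants.exists_coverable {F : Finset (Finset α)} (hQ : HasPendants F)
    (h3 : ∀ e ∈ F, 3 ≤ e.card) (h2 : DegreeLeTwo F) (hL : Linear F) (hne : F.Nonempty) :
    ∃ t, Coverable F t ∧ 3 * t + 1 ≤ weight F := by
  induction hn : F.card using Nat.strong_induction_on generalizing F with
  | _ n ih =>
  have ih' : ∀ F' ⊆ F, F'.card < F.card →
      ∃ t, Coverable F' t ∧ 3 * t ≤ weight F' ∧ (F'.Nonempty → 3 * t + 1 ≤ weight F') := by
    intro F' hF' hlt
    rcases F'.eq_empty_or_nonempty with rfl | hne'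
    · exact ⟨0, coverable_empty, by simp, by simp⟩
    · obtain ⟨t, ht, htw⟩ := ih _ (hn ▸ hlt) (hQ.mono h2 hF') (fun e he => h3 e (hF' he))
        (h2.mono hF') (hL.mono hF') hne' rfl
      exact ⟨t, ht, by omega, fun _ => htw⟩
  obtain ⟨e, he, w, hwe, hw⟩ := hQ F Subset.rfl hne fun _ _ f hf _ _ _ => hf
  by_cases hiso : ∃ f ∈ F, f ≠ e ∧ ∃ x ∈ e, x ∈ f
  · obtain ⟨f, hf, hfe, x, hxe, hxf⟩ := hiso
    have hwx : w ≠ x := by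
      rintro rfl
      exact hfe (hw f hf hxf)
    by_cases hg : ∃ g ∈ F, g ≠ e ∧ g ≠ f ∧ ∃ y ∈ g, y ∈ e ∨ y ∈ f
    · obtain ⟨g, hg, hge, hgf, y, hyg, hy⟩ := hg
      have hwy : w ≠ y := by
        rintro rfl
        exact hge (hw g hg hyg)
      have hxy : x ≠ y := by
        rintro rfl
        rcases h2 x e he f hf g hg hxe hxf hyg with h | h | h
        exacts [hfe h.symm, hge h.symm, hgf h.symm]
      have hsub := avoiding_subset F x y
      have heA : e ∉ avoiding F x y := fun h => (mem_avoiding.1 h).2.1 hxe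
      have hfA : f ∉ avoiding F x y := fun h => (mem_avoiding.1 h).2.1 hxf
      have hgA : g ∉ avoiding F x y := fun h => (mem_avoiding.1 h).2.2 hyg
      obtain ⟨t, ht, -, htw⟩ := ih' _ hsub (card_lt_of_subset_of_notMem hsub he heA)
      have hcov : Coverable F (t + 2) := by
        rcases hy with hy | hy
        · exact ht.add_pair hxy he hxe hy
        · exact ht.add_pair hxy hf hxf hy
      have hRc : ({e, f, g} : Finset (Finset α)).card = 3 := by
        rw [card_eq_three]
        exact ⟨e, f, g, hfe.symm, hge.symm, hgf.symm, rfl⟩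
      have hRs : ({e, f, g} : Finset (Finset α)) ⊆ F := by
        intro a ha
        simp only [mem_insert, mem_singleton] at ha
        rcases ha with rfl | rfl | rfl <;> assumption
      have hRA : ∀ a ∈ ({e, f, g} : Finset (Finset α)), a ∉ avoiding F x y := by
        intro a ha
        simp only [mem_insert, mem_singleton] at ha
        rcases ha with rfl | rfl | rfl <;> assumption
      rcases (avoiding F x y).eq_empty_or_nonempty with hA | hA
      · rw [hA] at ht hRA
        have hcov' : Coverable F (0 + 2) := by
          have h0 := coverable_empty (α := α)
          rw [← hA] at h0
          rcases hy with hy | hy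
          · exact h0.add_pair hxy he hxe hy
          · exact h0.add_pair hxy hf hxf hy
        have := weight_add_le (U := e ∪ f) (empty_subset F) hRs
          (union_subset (subset_biUnion_of_mem id he) (subset_biUnion_of_mem id hf)) hRA (by simp)
        have := four_le_card_union (h3 e he) (h3 f hf) hfe.symm
        exact ⟨_, hcov', by omega⟩
      · have hUc : ({w, x, y} : Finset α).card = 3 := by
          rw [card_eq_three]
          exact ⟨w, x, y, hwx, hwy, hxy, rfl⟩
        have := weight_add_le (U := {w, x, y}) hsub hRs (by
          intro a ha
          simp only [mem_insert, mem_singleton] at ha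
          rw [mem_biUnion_id]
          rcases ha with rfl | rfl | rfl
          exacts [⟨e, he, hwe⟩, ⟨e, he, hxe⟩, ⟨g, hg, hyg⟩]) hRA (by
          intro a ha b hb hab
          obtain ⟨hbF, hxb, hyb⟩ := mem_avoiding.1 hb
          simp only [mem_insert, mem_singleton] at ha
          rcases ha with rfl | rfl | rfl
          exacts [heA (hw b hbF hab ▸ hb), hxb hab, hyb hab])
        have := htw hA
        exact ⟨_, hcov, by omega⟩
    · push Not at hg
      obtain ⟨y, hye, hxy⟩ := exists_mem_ne_of_three_le_card (h3 e he) x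
      have hsub := avoiding_subset F x y
      have heA : e ∉ avoiding F x y := fun h => (mem_avoiding.1 h).2.1 hxe
      have hfA : f ∉ avoiding F x y := fun h => (mem_avoiding.1 h).2.1 hxf
      obtain ⟨t, ht, htw, -⟩ := ih' _ hsub (card_lt_of_subset_of_notMem hsub he heA)
      have := weight_add_le (R := {e, f}) (U := e ∪ f) hsub (by
          intro a ha
          simp only [mem_insert, mem_singleton] at ha
          rcases ha with rfl | rfl <;> assumption)
        (union_subset (subset_biUnion_of_mem id he) (subset_biUnion_of_mem id hf)) (by
          intro a ha
          simp only [mem_insert, mem_singleton] at ha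
          rcases ha with rfl | rfl <;> assumption) (by
          intro a ha b hb hab
          have hbF := hsub hb
          have h4 := hg b hbF (fun h => heA (h ▸ hb)) (fun h => hfA (h ▸ hb)) a hab
          rcases mem_union.1 ha with ha | ha
          exacts [h4.1 ha, h4.2 ha])
      have := hL.five_le_card_union he hf hfe.symm (h3 e he) (h3 f hf)
      rw [card_pair hfe.symm] at *
      exact ⟨_, ht.add_pair hxy he hxe hye, by omega⟩
  · push Not at hiso
    obtain ⟨t, ht, htw, -⟩ := ih' (F \ {e}) sdiff_subset
      (card_lt_of_subset_of_notMem sdiff_subset he (by simp))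
    have hcl : IsClosedIn F {e} := by
      intro a ha f hf v hva hvf
      rw [mem_singleton] at ha ⊢
      subst ha
      by_contra hfe
      exact hiso f hf hfe v hva hvf
    have hu : {e} ∪ F \ {e} = F := union_sdiff_of_subset (singleton_subset_iff.2 he)
    have hw' := weight_union (C := {e}) (fun a ha => by
      rw [mem_singleton] at ha
      exact ⟨w, ha ▸ hwe⟩) hcl.disjoint_sdiff
    have hc := (coverable_singleton e).union hcl.disjoint_sdiff ht
    rw [hu] at hw' hc
    have h1 : weight {e} = e.card + 1 := by simp [weight]
    have := h3 e he
    exact ⟨_, hc, by omega⟩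

/-- A finite family of sets with at least three elements is coverable at a cost of a third of
its weight. -/
theorem exists_coverable (F : Finset (Finset α)) (h3 : ∀ e ∈ F, 3 ≤ e.card) :
    ∃ t, Coverable F t ∧ 3 * t ≤ weight F := by
  induction hn : F.card using Nat.strong_induction_on generalizing F with
  | _ n ih =>
  subst hn
  have ih' : ∀ F' ⊆ F, ∀ e ∈ F, e ∉ F' → ∃ t, Coverable F' t ∧ 3 * t ≤ weight F' :=
    fun F' hF' e he he' => ih _ (card_lt_of_subset_of_notMem hF' he he') F'
      (fun e he => h3 e (hF' he)) rfl
  by_cases hconn : ∃ C ⊆ F, C.Nonempty ∧ IsClosedIn F C ∧ C ≠ F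
  · obtain ⟨C, hCF, ⟨a, ha⟩, hcl, hCne⟩ := hconn
    obtain ⟨b, hb, hbC⟩ := exists_of_ssubset (hCF.ssubset_of_ne hCne)
    obtain ⟨s, hs, hsw⟩ := ih' C hCF b hb hbC
    obtain ⟨t, ht, htw⟩ := ih' (F \ C) sdiff_subset a (hCF ha) (by simp [ha])
    have hu : C ∪ F \ C = F := union_sdiff_of_subset hCF
    have hw := weight_union (fun e he => card_pos.1 (by have := h3 e (hCF he); omega))
      hcl.disjoint_sdiff
    have hc := hs.union hcl.disjoint_sdiff ht
    rw [hu] at hw hc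
    exact ⟨_, hc, by omega⟩
  push Not at hconn
  -- Removing an adjacent pair of vertices that accounts for a weight of six.
  have reduce : ∀ x y, x ≠ y → ∀ e ∈ F, x ∈ e → y ∈ e → ∀ R ⊆ F, (∀ a ∈ R, x ∈ a ∨ y ∈ a) →
      ∀ U ⊆ F.biUnion id, (∀ v ∈ U, ∀ a ∈ F, v ∈ a → x ∈ a ∨ y ∈ a) → 6 ≤ R.card + U.card →
      ∃ t, Coverable F t ∧ 3 * t ≤ weight F := by
    intro x y hxy e he hxe hye R hR hRA U hU hUA h6
    have heA : e ∉ avoiding F x y := fun h => (mem_avoiding.1 h).2.1 hxe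
    obtain ⟨t, ht, htw⟩ := ih' _ (avoiding_subset F x y) e he heA
    have := weight_add_le (avoiding_subset F x y) hR hU (by
      intro a ha h
      have := mem_avoiding.1 h
      have := hRA a ha
      tauto) (by
      intro v hv a ha hva
      have := mem_avoiding.1 ha
      have := hUA v hv a this.1 hva
      tauto)
    exact ⟨_, ht.add_pair hxy he hxe hye, by omega⟩
  rcases F.eq_empty_or_nonempty with rfl | ⟨e, he⟩
  · exact ⟨0, coverable_empty, by simp⟩
  by_cases hone : F = {e}
  · subst hone
    have := h3 e he
    exact ⟨1, coverable_singleton e, by simp [weight]; omega⟩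
  have hmeet : ∃ f ∈ F, f ≠ e ∧ ∃ x ∈ e, x ∈ f := by
    by_contra! hno
    refine hone (hconn {e} (singleton_subset_iff.2 he) (singleton_nonempty e) ?_).symm
    intro a ha f hf v hva hvf
    rw [mem_singleton] at ha ⊢
    subst ha
    by_contra hfe
    exact hno f hf hfe v hva hvf
  obtain ⟨f, hf, hfe, x, hxe, hxf⟩ := hmeet
  by_cases h2 : DegreeLeTwo F
  swap
  · unfold DegreeLeTwo at h2
    push Not at h2
    obtain ⟨x, e, he, f, hf, g, hg, hxe, hxf, hxg, hef, heg, hfg⟩ := h2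
    have hRs : ({e, f, g} : Finset (Finset α)) ⊆ F := by
      intro a ha
      simp only [mem_insert, mem_singleton] at ha
      rcases ha with rfl | rfl | rfl <;> assumption
    have hRx : ∀ a ∈ ({e, f, g} : Finset (Finset α)), x ∈ a := by
      intro a ha
      simp only [mem_insert, mem_singleton] at ha
      rcases ha with rfl | rfl | rfl <;> assumption
    have hRc : ({e, f, g} : Finset (Finset α)).card = 3 := by
      rw [card_eq_three]
      exact ⟨e, f, g, hef, heg, hfg, rfl⟩
    by_cases hcl : IsClosedIn F (F.filter (x ∈ ·))
    · have hall := hconn _ (filter_subset _ _) ⟨e, by simp [he, hxe]⟩ hcl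
      have hx : ∀ a ∈ F, x ∈ a := fun a ha => by
        rw [← hall, mem_filter] at ha
        exact ha.2
      obtain ⟨y, hye, hxy⟩ := exists_mem_ne_of_three_le_card (h3 e he) x
      refine reduce x y hxy e he hxe hye {e, f, g} hRs (fun a ha => Or.inl (hRx a ha)) e
        (subset_biUnion_of_mem id he) (fun v _ a ha _ => Or.inl (hx a ha)) ?_
      have := h3 e he
      omega
    · unfold IsClosedIn at hcl
      push Not at hcl
      obtain ⟨a, ha, b, hb, y, hya, hyb, hbx⟩ := hcl
      rw [mem_filter] at ha
      have hxb : x ∉ b := fun h => hbx (mem_filter.2 ⟨hb, h⟩)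
      have hxy : x ≠ y := fun h => hxb (h ▸ hyb)
      refine reduce x y hxy a ha.1 ha.2 hya (insert b {e, f, g})
        (insert_subset hb hRs) ?_ {x, y} ?_ ?_ ?_
      · intro c hc
        rcases mem_insert.1 hc with rfl | hc
        exacts [Or.inr hyb, Or.inl (hRx c hc)]
      · intro v hv
        rw [mem_biUnion_id]
        simp only [mem_insert, mem_singleton] at hv
        rcases hv with rfl | rfl
        exacts [⟨a, ha.1, ha.2⟩, ⟨a, ha.1, hya⟩]
      · intro v hv c _ hvc
        simp only [mem_insert, mem_singleton] at hv
        rcases hv with rfl | rfl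
        exacts [Or.inl hvc, Or.inr hvc]
      · rw [card_insert_of_notMem (fun h => hxb (hRx b h)), hRc, card_pair hxy]
  -- Two intersecting edges are all of `F`, or a third edge meets their union.
  have third : ∀ e ∈ F, ∀ f ∈ F, F = {e, f} ∨ ∃ g ∈ F, g ≠ e ∧ g ≠ f ∧ ∃ y ∈ g, y ∈ e ∨ y ∈ f := by
    intro e he f hf
    by_contra! hno
    refine hno.1 (hconn {e, f} ?_ ⟨e, by simp⟩ ?_).symm
    · intro a ha
      simp only [mem_insert, mem_singleton] at ha
      rcases ha with rfl | rfl <;> assumption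
    · intro a ha g hg v hva hvg
      simp only [mem_insert, mem_singleton] at ha ⊢
      by_contra! hne
      have h4 := hno.2 g hg hne.1 hne.2 v hvg
      rcases ha with rfl | rfl
      exacts [h4.1 hva, h4.2 hva]
  have pair : ∀ e f : Finset α, F = {e, f} → e ≠ f → ∀ x ∈ e, x ∈ f →
      ∃ t, Coverable F t ∧ 3 * t ≤ weight F := by
    intro e f hFef hef x hxe hxf
    have he : e ∈ F := by simp [hFef]
    have hf : f ∈ F := by simp [hFef]
    obtain ⟨y, hye, hxy⟩ := exists_mem_ne_of_three_le_card (h3 e he) x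
    have hx : ∀ a ∈ F, x ∈ a := by
      intro a ha
      rw [hFef] at ha
      simp only [mem_insert, mem_singleton] at ha
      rcases ha with rfl | rfl <;> assumption
    refine reduce x y hxy e he hxe hye F Subset.rfl (fun a ha => Or.inl (hx a ha)) (e ∪ f)
      (union_subset (subset_biUnion_of_mem id he) (subset_biUnion_of_mem id hf))
      (fun v _ a ha _ => Or.inl (hx a ha)) ?_
    have h1 := four_le_card_union (h3 e he) (h3 f hf) hef
    have h4 : F.card = 2 := by rw [hFef, card_pair hef]
    omega
  have triple : ∀ e ∈ F, ∀ f ∈ F, e ≠ f → ∀ x ∈ e, x ∈ f → ∀ g ∈ F, g ≠ e → g ≠ f →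
      ∀ y ∈ g, x ≠ y := by
    rintro e he f hf hef x hxe hxf g hg hge hgf y hyg rfl
    rcases h2 x e he f hf g hg hxe hxf hyg with h | h | h
    exacts [hef h, hge h.symm, hgf h.symm]
  by_cases hL : Linear F
  swap
  · unfold Linear at hL
    push Not at hL
    obtain ⟨e, he, f, hf, hef, x, hxe, hxf, z, hze, hzf, hxz⟩ := hL
    rcases third e he f hf with hF | ⟨g, hg, hge, hgf, y, hyg, hy⟩
    · exact pair e f hF hef x hxe hxf
    have hxy := triple e he f hf hef x hxe hxf g hg hge hgf y hyg
    have hzy := triple e he f hf hef z hze hzf g hg hge hgf y hyg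
    have hcom : ∃ a ∈ F, x ∈ a ∧ y ∈ a := by
      rcases hy with hy | hy
      exacts [⟨e, he, hxe, hy⟩, ⟨f, hf, hxf, hy⟩]
    obtain ⟨a, ha, hxa, hya⟩ := hcom
    refine reduce x y hxy a ha hxa hya {e, f, g} ?_ ?_ {x, z, y} ?_ ?_ ?_
    · intro b hb
      simp only [mem_insert, mem_singleton] at hb
      rcases hb with rfl | rfl | rfl <;> assumption
    · intro b hb
      simp only [mem_insert, mem_singleton] at hb
      rcases hb with rfl | rfl | rfl
      exacts [Or.inl hxe, Or.inl hxf, Or.inr hyg]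
    · intro v hv
      rw [mem_biUnion_id]
      simp only [mem_insert, mem_singleton] at hv
      rcases hv with rfl | rfl | rfl
      exacts [⟨e, he, hxe⟩, ⟨e, he, hze⟩, ⟨g, hg, hyg⟩]
    · intro v hv b hb hvb
      simp only [mem_insert, mem_singleton] at hv
      rcases hv with rfl | rfl | rfl
      · exact Or.inl hvb
      · rcases h2 v e he f hf b hb hze hzf hvb with h | rfl | rfl
        exacts [absurd h hef, Or.inl hxe, Or.inl hxf]
      · exact Or.inr hvb
    · rw [card_eq_three.2 ⟨e, f, g, hef, hge.symm, hgf.symm, rfl⟩,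
        card_eq_three.2 ⟨x, z, y, hxz, hxy, hzy, rfl⟩]
  rcases third e he f hf with hF | ⟨g, hg, hge, hgf, y, hyg, hy⟩
  · exact pair e f hF hfe.symm x hxe hxf
  have hxy := triple e he f hf hfe.symm x hxe hxf g hg hge hgf y hyg
  have hcom : ∃ a ∈ F, x ∈ a ∧ y ∈ a := by
    rcases hy with hy | hy
    exacts [⟨e, he, hxe, hy⟩, ⟨f, hf, hxf, hy⟩]
  obtain ⟨a, ha, hxa, hya⟩ := hcom
  have hRc : ({e, f, g} : Finset (Finset α)).card = 3 :=
    card_eq_three.2 ⟨e, f, g, hfe.symm, hge.symm, hgf.symm, rfl⟩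
  have hRs : ({e, f, g} : Finset (Finset α)) ⊆ F := by
    intro b hb
    simp only [mem_insert, mem_singleton] at hb
    rcases hb with rfl | rfl | rfl <;> assumption
  have hRA : ∀ b ∈ ({e, f, g} : Finset (Finset α)), x ∈ b ∨ y ∈ b := by
    intro b hb
    simp only [mem_insert, mem_singleton] at hb
    rcases hb with rfl | rfl | rfl
    exacts [Or.inl hxe, Or.inl hxf, Or.inr hyg]
  have hsub := avoiding_subset F x y
  have hnotA : ∀ b, x ∈ b ∨ y ∈ b → b ∉ avoiding F x y := by
    intro b hb h
    have := mem_avoiding.1 h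
    tauto
  rcases (avoiding F x y).eq_empty_or_nonempty with hA | hA
  · refine reduce x y hxy a ha hxa hya {e, f, g} hRs hRA e (subset_biUnion_of_mem id he) ?_ ?_
    · intro v _ b hb _
      by_contra hno
      push Not at hno
      have hbA : b ∈ avoiding F x y := mem_avoiding.2 ⟨hb, hno⟩
      simp [hA] at hbA
    · have := h3 e he
      omega
  · have hQ : HasPendants (avoiding F x y) := by
      refine h2.hasPendants hsub fun C hC hne hcl => ?_
      have hCF := hconn C (hC.trans hsub) hne hcl
      exact absurd (hC (hCF ▸ he)) (hnotA e (Or.inl hxe))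
    obtain ⟨t, ht, htw⟩ := hQ.exists_coverable (fun b hb => h3 b (hsub hb)) (h2.mono hsub)
      (hL.mono hsub) hA
    have hw := weight_add_le (U := {x, y}) hsub hRs (by
      intro v hv
      rw [mem_biUnion_id]
      simp only [mem_insert, mem_singleton] at hv
      rcases hv with rfl | rfl
      exacts [⟨e, he, hxe⟩, ⟨g, hg, hyg⟩]) (fun b hb => hnotA b (hRA b hb)) (by
      intro v hv b hb hvb
      simp only [mem_insert, mem_singleton] at hv
      rcases hv with rfl | rfl
      exacts [hnotA b (Or.inl hvb) hb, hnotA b (Or.inr hvb) hb])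
    rw [hRc, card_pair hxy] at hw
    exact ⟨_, ht.add_pair hxy ha hxa hya, by omega⟩

end Hypergraph.Family

namespace Hypergraph

open Finset

lemma MemClass.exists_isTotalTransversal {α : Type*} {k : ℕ} (hk : 3 ≤ k) {H : Hypergraph α}
    (hH : H.MemClass k) :
    ∃ T : Set α, H.IsTotalTransversal T ∧ 3 * T.ncard ≤ H.order + H.size := by
  classical
  have hVfin := hH.finite
  have hEfin : H.edgeSet.Finite := hVfin.finite_subsets.subset fun e he =>
    H.subset_vertexSet_of_mem_edgeSet he
  have hFfin : {s : Finset α | (s : Set α) ∈ H.edgeSet}.Finite :=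
    hEfin.preimage (Finset.coe_injective.injOn)
  let F : Finset (Finset α) := hFfin.toFinset
  have hmem : ∀ s : Finset α, s ∈ F ↔ (s : Set α) ∈ H.edgeSet := by simp [F]
  have hlift : ∀ e ∈ H.edgeSet, ∃ s ∈ F, (s : Set α) = e := by
    intro e he
    have hs := (hH.uniform e he).1
    exact ⟨hs.toFinset, by simp [hmem, he], by simp⟩
  have h3 : ∀ s ∈ F, 3 ≤ s.card := by
    intro s hs
    have := (hH.uniform _ ((hmem s).1 hs)).2
    rw [Set.ncard_coe_finset] at this
    omega
  have hV : ((F.biUnion id : Finset α) : Set α) = H.vertexSet := by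
    ext v
    rw [Finset.mem_coe, Family.mem_biUnion_id]
    constructor
    · rintro ⟨s, hs, hv⟩
      exact H.subset_vertexSet_of_mem_edgeSet ((hmem s).1 hs) hv
    · intro hv
      have := hH.no_isolated_vertex v hv
      unfold IsIsolated at this
      push Not at this
      obtain ⟨e, he, hve⟩ := this
      obtain ⟨s, hs, rfl⟩ := hlift e he
      exact ⟨s, hs, hve⟩
  have hE : ((F.map ⟨_, Finset.coe_injective⟩ : Finset (Set α)) : Set (Set α)) = H.edgeSet := by
    ext e
    simp only [coe_map, Function.Embedding.coeFn_mk, Set.mem_image, Finset.mem_coe]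
    constructor
    · rintro ⟨s, hs, rfl⟩
      exact (hmem s).1 hs
    · exact hlift e
  have hord : H.order = (F.biUnion id).card := by
    rw [order, ← hV, Set.ncard_coe_finset]
  have hsize : H.size = F.card := by
    rw [size, ← hE, Set.ncard_coe_finset, card_map]
  obtain ⟨t, ht, htw⟩ := Family.exists_coverable F h3
  rcases isEmpty_or_nonempty α with hα | hα
  · refine ⟨∅, ⟨⟨Set.empty_subset _, fun e he => ?_⟩, by simp⟩, by simp⟩
    obtain ⟨s, hs, -⟩ := hlift e he
    have := h3 s hs
    simp [Finset.eq_empty_of_isEmpty s] at this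
  have hc : ∀ s : Finset α, ∃ v, s ∈ F → v ∈ s := by
    intro s
    by_cases hs : s ∈ F
    · obtain ⟨v, hv⟩ := card_pos.1 (by have := h3 s hs; omega : 0 < s.card)
      exact ⟨v, fun _ => hv⟩
    · exact ⟨Classical.arbitrary α, fun h => absurd h hs⟩
  choose c hc using hc
  obtain ⟨T, hT, hTs, hT1, hT2⟩ := ht c hc
  refine ⟨T, ⟨⟨hV ▸ Finset.coe_subset.2 hTs, ?_⟩, ?_⟩, ?_⟩
  · intro e he
    obtain ⟨s, hs, rfl⟩ := hlift e he
    obtain ⟨v, hv, hvs⟩ := hT1 s hs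
    exact ⟨v, hv, hvs⟩
  · intro v hv
    rcases hT2 v hv with ⟨u, hu, huv, s, hs, hus, hvs⟩ | ⟨s, ⟨hs, hiso⟩, -⟩
    · exact ⟨u, hu, huv, s, (hmem s).1 hs, hus, hvs⟩
    · refine absurd ⟨(hmem s).1 hs, fun f hf hne => ?_⟩ (hH.no_isolated_edge s)
      obtain ⟨r, hr, rfl⟩ := hlift f hf
      rw [Set.disjoint_left]
      intro w hw hwr
      exact hne (congrArg _ (hiso r hr w hw hwr))
  · rw [Set.ncard_coe_finset, hord, hsize]
    unfold Family.weight at htw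
    omega

end Hypergraph

theorem mainTheorem7 {α : Type*} (k : ℕ) (hk : 3 ≤ k) (H : Hypergraph α)
    (hH : Hypergraph.MemClass k H) :
    (∃ T : Set α, H.IsTotalTransversal T) ∧
      (H.totalTransversalNumber : ℝ) ≤ ((H.order : ℝ) + (H.size : ℝ)) / 3 := by
  obtain ⟨T, hT, hcard⟩ := hH.exists_isTotalTransversal hk
  refine ⟨⟨T, hT⟩, ?_⟩
  have h : H.totalTransversalNumber ≤ T.ncard := Nat.sInf_le ⟨T, hT, rfl⟩
  have h' : 3 * H.totalTransversalNumber ≤ H.order + H.size := by omega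
  have h'' : (3 : ℝ) * H.totalTransversalNumber ≤ H.order + H.size := by exact_mod_cast h'
  linarith
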